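/- Let $G$ be a finite group and $H\le G$. Write $\mathrm{Irr}(G)$ for the set of irreducible complex characters of $G$, $\chi_H$ for the restriction of $\chi$ to $H$, $1_H$ for the trivial character of $H$, and $[\alpha,\beta]=|H|^{-1}\sum_{h\in H}\alpha(h)\overline{\beta(h)}$. A proper subgroup $H<G$ is called rich in $G$ if $[\chi_H,1_H]\neq 0$ for all $\chi\in\mathrm{Irr}(G)$. The Frobenius graph $\Gamma(G,H)$ is the bipartite graph on the disjoint union of $\mathrm{Irr}(G)$ and $\mathrm{Irr}(H)$ in which $\chi\in\mathrm{Irr}(G)$ and $\varphi\in\mathrm{Irr}(H)$ are joined if and only if $[\chi_H,\varphi]\ne 0$. Groups $G_1,G_2$ are isoclinic if there are isomorphisms $\theta\colon G_1/Z(G_1)\to G_2/Z(G_2)$ and $\psi\colon G_1'\to G_2'$ such that $\psi([a,b])=[c,d]$ whenever $\theta(aZ(G_1))=cZ(G_2)$ and $\theta(bZ(G_1))=dZ(G_2)$. Let $G_1$ and $G_2$ be isoclinic finite groups and let $H_1$ be a proper subgroup of $G_1$. (1) If $H_1$ is rich in $G_1$ and $H_1\neq 1$, then there is a proper subgroup $H_2\ne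 1$ of $G_2$ that is rich in $G_2$. If $H_1$ is rich in $G_1$ (possibly $H_1=1$) and $G_2\neq 1$, then there is a proper subgroup $H_2$ of $G_2$ that is rich in $G_2$. (2) If $\Gamma(G_1,H_1)$ has diameter $3$, then there is a proper subgroup $H_2$ of $G_2$ such that $\Gamma(G_2,H_2)$ has diameter $3$. -/

import Mathlib

namespace FrobeniusDiam

open scoped commutatorElement

/-- `Irr(G)`: the set of characters of irreducible complex representations of `G`, as functions
`G → ℂ` (every finite-dimensional representation can be realised on some `ℂⁿ`). -/
def Irr (G : Type*) [Group G] : Set (G → ℂ) :=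
  {χ | ∃ (n : ℕ) (ρ : Representation ℂ G (Fin n → ℂ)), ρ.IsIrreducible ∧ ρ.character = χ}

/-- The inner product `[α, β] = |G|⁻¹ ∑ g, α g * conj (β g)` of class functions on a finite
group. -/
noncomputable def charInner {G : Type*} [Group G] [Finite G] (α β : G → ℂ) : ℂ :=
  (Nat.card G : ℂ)⁻¹ * ∑ᶠ g : G, α g * (starRingEnd ℂ) (β g)

/-- The restriction `χ_H` to the subgroup `H` of a function `χ` on `G`. -/
def res {G : Type*} [Group G] (H : Subgroup G) (χ : G → ℂ) : H → ℂ := fun h => χ (h : G)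

/-- `H` is rich in `G`: it is a proper subgroup and `[χ_H, 1_H] ≠ 0` for all `χ ∈ Irr(G)`. -/
def IsRich {G : Type*} [Group G] [Finite G] (H : Subgroup G) : Prop :=
  H ≠ ⊤ ∧ ∀ χ ∈ Irr G, charInner (res H χ) (fun _ => 1) ≠ 0

/-- The Frobenius graph `Γ(G, H)`: the bipartite graph on the disjoint union of `Irr(G)` and
`Irr(H)` in which `χ ∈ Irr(G)` and `φ ∈ Irr(H)` are adjacent iff `[χ_H, φ] ≠ 0`. -/
def frobeniusGraph {G : Type*} [Group G] [Finite G] (H : Subgroup G) :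
    SimpleGraph (Irr G ⊕ Irr H) where
  Adj
    | .inl χ, .inr φ => charInner (res H χ.1) φ.1 ≠ 0
    | .inr φ, .inl χ => charInner (res H χ.1) φ.1 ≠ 0
    | .inl _, .inl _ => False
    | .inr _, .inr _ => False
  symm := ⟨by
    rintro (a | a) (b | b) h <;> exact h⟩
  loopless := ⟨by
    rintro (a | a) h <;> exact h⟩

/-- Isoclinism of groups: there are isomorphisms `θ : G₁/Z(G₁) → G₂/Z(G₂)` and `ψ : G₁' → G₂'`
such that `ψ [a, b] = [c, d]` whenever `θ (a Z(G₁)) = c Z(G₂)` and `θ (b Z(G₁)) = d Z(G₂)`. -/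
def Isoclinic (G₁ G₂ : Type*) [Group G₁] [Group G₂] : Prop :=
  ∃ (θ : (G₁ ⧸ Subgroup.center G₁) ≃* (G₂ ⧸ Subgroup.center G₂))
    (ψ : commutator G₁ ≃* commutator G₂),
    ∀ (a b : G₁) (c d : G₂), θ (a : G₁ ⧸ Subgroup.center G₁) = (c : G₂ ⧸ Subgroup.center G₂) →
      θ (b : G₁ ⧸ Subgroup.center G₁) = (d : G₂ ⧸ Subgroup.center G₂) →
      ((ψ ⟨⁅a, b⁆, Subgroup.commutator_mem_commutator (Subgroup.mem_top a)
        (Subgroup.mem_top b)⟩ : commutator G₂) : G₂) = ⁅c, d⁆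

end FrobeniusDiam

/-! Both conditions force `[χ_H, 1_H] ≠ 0` for every irreducible `χ`. Applied to linear characters,
this puts `H₁` inside the commutator subgroup `G₁'` (`le_commutator_of_forall`), so only
restrictions to `G₁'` matter.

Isoclinism matches these restrictions. Let `P` be the fibre product of `G₁` and `G₂` over the common
central quotient; `P'` is the graph of `ψ`, so the kernel of `P → G₁` meets `P'` trivially, and its
image in `G₂` is central. The central character of an irreducible representation of `G₂`, pulled
back to this kernel, extends to a linear character `f` of `P` trivial on `P'`. Dividing by `f` gives
an irreducible representation that factors through `G₁` and has the same character on `P'`.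

Hence `H₂ = ψ(H₁)` inherits richness, and diameter 3 as well once the latter is phrased by common
neighbours. It is proper when `G₂ ≠ 1`: if `H₂ = G₂`, every irreducible representation would be
trivial, hence so would the regular one. -/

namespace FrobeniusDiam

open Representation
open scoped commutatorElement

/-! ### Irreducible representations, invariants and linear characters -/

section Representations

variable {G V : Type*} [Group G] [AddCommGroup V] [Module ℂ V]

theorem isIrreducible_iff (ρ : Representation ℂ G V) :
    ρ.IsIrreducible ↔ Nontrivial V ∧
      ∀ U : Submodule ℂ V, (∀ g, ∀ v ∈ U, ρ g v ∈ U) → U = ⊥ ∨ U = ⊤ := by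
  constructor
  · intro h
    refine ⟨?_, fun U hU => ?_⟩
    · by_contra hV
      rw [not_nontrivial_iff_subsingleton] at hV
      have : (⊥ : Subrepresentation ρ) = ⊤ :=
        Subrepresentation.toSubmodule_injective (Subsingleton.elim _ _)
      exact bot_ne_top this
    · rcases eq_bot_or_eq_top (⟨U, fun g v hv => hU g v hv⟩ : Subrepresentation ρ) with h | h
      · exact .inl (congrArg Subrepresentation.toSubmodule h)
      · exact .inr (congrArg Subrepresentation.toSubmodule h)
  · rintro ⟨hV, h⟩
    refine { exists_pair_ne := ⟨⊥, ⊤, fun e => ?_⟩, eq_bot_or_eq_top := fun U => ?_ }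
    · exact bot_ne_top (congrArg Subrepresentation.toSubmodule e)
    · rcases h U.toSubmodule (fun g v hv => U.apply_mem_toSubmodule g hv) with e | e
      · exact .inl (Subrepresentation.toSubmodule_injective e)
      · exact .inr (Subrepresentation.toSubmodule_injective e)

theorem character_mem_Irr [FiniteDimensional ℂ V] (ρ : Representation ℂ G V)
    (h : ρ.IsIrreducible) : ρ.character ∈ Irr G := by
  let e : V ≃ₗ[ℂ] (Fin (Module.finrank ℂ V) → ℂ) := LinearEquiv.ofFinrankEq _ _ (by simp)
  let σ : Representation ℂ G (Fin (Module.finrank ℂ V) → ℂ) :=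
    (e.conjAlgEquiv ℂ : _ →* _).comp ρ
  have hσ : ∀ g v, σ g v = e (ρ g (e.symm v)) := fun g v => rfl
  refine ⟨_, σ, ?_, ?_⟩
  · rw [isIrreducible_iff] at h ⊢
    obtain ⟨h1, h2⟩ := h
    refine ⟨e.symm.toEquiv.nontrivial, fun U hU => ?_⟩
    rcases h2 (U.comap e.toLinearMap) (fun g v hv => by
      have := hU g _ hv
      simpa [hσ] using this) with h | h
    · left
      rw [eq_bot_iff]
      intro v hv
      have : e.symm v ∈ U.comap e.toLinearMap := by simpa using hv
      rw [h] at this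
      simpa using this
    · right
      rw [eq_top_iff]
      intro v _
      have : e.symm v ∈ U.comap e.toLinearMap := by rw [h]; trivial
      simpa using this
  · ext g
    exact LinearMap.trace_conj' (ρ g) e

/-- The average of the character is the dimension of the invariants, a subrepresentation; being
nonzero, it is everything. -/
theorem forall_eq_one_of_sum_character_ne_zero [Fintype G] [FiniteDimensional ℂ V]
    (ρ : Representation ℂ G V) (h : ρ.IsIrreducible) (hs : ∑ g, ρ.character g ≠ 0) (g : G) :
    ρ g = 1 := by
  have : Invertible (Nat.card G : ℂ) :=
    invertibleOfNonzero (Nat.cast_ne_zero.2 Nat.card_pos.ne')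
  have h1 := card_inv_mul_sum_char_eq_finrank ρ
  have h2 : invariants ρ ≠ ⊥ := by
    intro e
    rw [e, finrank_bot, Nat.cast_zero, mul_eq_zero] at h1
    exact h1.elim (inv_ne_zero (Nat.cast_ne_zero.2 Nat.card_pos.ne')) hs
  have h3 := (((isIrreducible_iff ρ).1 h).2 (invariants ρ)
    (fun g v hv => by rw [(mem_invariants ρ v).1 hv g]; exact hv)).resolve_left h2
  ext v
  have : v ∈ invariants ρ := by rw [h3]; trivial
  exact this g

theorem character_eq_one_of_sum_ne_zero [Fintype G] [FiniteDimensional ℂ V]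
    (ρ : Representation ℂ G V) (h : ρ.IsIrreducible) (hs : ∑ g, ρ.character g ≠ 0) :
    ρ.character = fun _ => 1 := by
  have h1 := forall_eq_one_of_sum_character_ne_zero ρ h hs
  have h2 : Module.finrank ℂ V = 1 := by
    rw [← isSimpleModule_iff_finrank_eq_one, isSimpleModule_iff]
    obtain ⟨h3, h4⟩ := (isIrreducible_iff ρ).1 h
    exact { exists_pair_ne := ⟨⊥, ⊤, bot_ne_top⟩
            eq_bot_or_eq_top := fun U => h4 U fun g v hv => by rw [h1]; exact hv }
  ext g
  rw [character, h1, LinearMap.trace_one, h2, Nat.cast_one]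

/-- If every irreducible representation of a finite group is trivial, so is every
representation. -/
theorem forall_eq_one_of_forall_irreducible [Finite G]
    (H : ∀ χ ∈ Irr G, ∑ᶠ g, χ g ≠ 0) (n : ℕ) :
    ∀ (V : Type*) [AddCommGroup V] [Module ℂ V] [FiniteDimensional ℂ V]
      (ρ : Representation ℂ G V), Module.finrank ℂ V = n → ∀ g, ρ g = 1 := by
  have := Fintype.ofFinite G
  have : NeZero (Nat.card G : ℂ) := ⟨Nat.cast_ne_zero.2 Nat.card_pos.ne'⟩
  induction n using Nat.strong_induction_on with
  | _ n ih =>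
  intro V _ _ _ ρ hn g
  by_cases hV : Subsingleton V
  · ext v; exact Subsingleton.elim _ _
  rw [not_subsingleton_iff_nontrivial] at hV
  by_cases hirr : ρ.IsIrreducible
  · have := H _ (character_mem_Irr ρ hirr)
    rw [finsum_eq_sum_of_fintype] at this
    exact forall_eq_one_of_sum_character_ne_zero ρ hirr this g
  rw [isIrreducible_iff] at hirr
  push Not at hirr
  obtain ⟨U, hU, hb, ht⟩ := hirr hV
  let S : Subrepresentation ρ := ⟨U, fun g v hv => hU g v hv⟩
  -- Maschke's theorem: `U` and its complement are both proper, so induction applies to each.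
  obtain ⟨T, hT⟩ := exists_isCompl S
  have hsup : U ⊔ T.toSubmodule = ⊤ := congrArg Subrepresentation.toSubmodule hT.sup_eq_top
  have hinf : U ⊓ T.toSubmodule = ⊥ := congrArg Subrepresentation.toSubmodule hT.inf_eq_bot
  have hTt : T.toSubmodule ≠ ⊤ := fun e => hb (by rwa [e, inf_top_eq] at hinf)
  have key : ∀ R : Subrepresentation ρ, R.toSubmodule ≠ ⊤ → ∀ v ∈ R.toSubmodule, ρ g v = v := by
    intro R hR v hv
    have := ih _ (hn ▸ Submodule.finrank_lt hR) R.toSubmodule R.toRepresentation rfl g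
    exact congrArg Subtype.val (LinearMap.congr_fun this ⟨v, hv⟩)
  ext v
  obtain ⟨a, ha, b, hb, rfl⟩ := Submodule.mem_sup.1 (hsup ▸ Submodule.mem_top : v ∈ U ⊔ T.toSubmodule)
  rw [map_add, key S ht a ha, key T hTt b hb]; rfl

/-- The regular representation is faithful, yet it would be trivial. -/
theorem subsingleton_of_forall_irreducible [Finite G]
    (H : ∀ χ ∈ Irr G, ∑ᶠ g, χ g ≠ 0) : Subsingleton G := by
  have := Fintype.ofFinite G
  refine subsingleton_of_forall_eq 1 fun g => ?_
  have h := forall_eq_one_of_forall_irreducible H _ (MonoidAlgebra ℂ G)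
    (Representation.ofMulAction ℂ G G) rfl g
  have h2 := LinearMap.congr_fun h (MonoidAlgebra.single 1 1)
  simp only [ofMulAction_single, smul_eq_mul, mul_one, Module.End.one_apply] at h2
  exact MonoidAlgebra.of_injective (R := ℂ) h2

theorem linear_mem_Irr (f : G →* ℂˣ) : (fun g => (f g : ℂ)) ∈ Irr G := by
  let ρ : Representation ℂ G ℂ :=
    ((Algebra.lmul ℂ ℂ : ℂ →* Module.End ℂ ℂ).comp (Units.coeHom ℂ)).comp f
  have h : ρ.IsIrreducible := by
    rw [isIrreducible_iff]
    exact ⟨inferInstance, fun U _ => eq_bot_or_eq_top (α := Ideal ℂ) U⟩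
  convert character_mem_Irr ρ h using 1
  ext g
  have : ρ g = (f g : ℂ) • LinearMap.id := by ext; simp [ρ]
  simp [character, this]

theorem one_mem_Irr : (fun _ => 1) ∈ Irr G := by
  simpa using linear_mem_Irr (1 : G →* ℂˣ)

theorem charInner_one_ne_zero_iff [Finite G] (χ : G → ℂ) :
    charInner χ (fun _ => 1) ≠ 0 ↔ ∑ᶠ g, χ g ≠ 0 := by
  simp [charInner, Nat.card_pos.ne']

theorem eq_one_of_charInner_one_ne_zero [Finite G] {φ : G → ℂ} (hφ : φ ∈ Irr G)
    (h : charInner (fun _ => 1) φ ≠ 0) : φ = fun _ => 1 := by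
  have := Fintype.ofFinite G
  obtain ⟨n, ρ, hρ, rfl⟩ := hφ
  refine character_eq_one_of_sum_ne_zero ρ hρ fun hs => h ?_
  simp [charInner, finsum_eq_sum_of_fintype, ← map_sum, hs]

theorem apply_one_ne_zero {χ : G → ℂ} (hχ : χ ∈ Irr G) : χ 1 ≠ 0 := by
  obtain ⟨n, ρ, hρ, rfl⟩ := hχ
  have := ((isIrreducible_iff ρ).1 hρ).1
  rw [char_one]
  exact Nat.cast_ne_zero.2 Module.finrank_pos.ne'

/-- Linear characters separate the points of the abelianization, and one whose sum over `H` is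
nonzero is trivial on `H`. -/
theorem le_commutator_of_forall [Finite G] (H : Subgroup G)
    (h : ∀ χ ∈ Irr G, charInner (res H χ) (fun _ => 1) ≠ 0) : H ≤ commutator G := by
  intro x hx
  by_contra hx'
  have h1 : Abelianization.of x ≠ 1 := fun e => hx' ((QuotientGroup.eq_one_iff x).1 e)
  obtain ⟨f, hf⟩ := CommGroup.exists_apply_ne_one_of_hasEnoughRootsOfUnity _ ℂ h1
  have h2 := h _ (linear_mem_Irr (f.comp Abelianization.of))
  have := Fintype.ofFinite H
  have h3 : ((fun y : H => (f (Abelianization.of (y : G)) : ℂ))) = fun _ => 1 := by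
    have h4 := linear_mem_Irr ((f.comp Abelianization.of).comp H.subtype)
    obtain ⟨n, ρ, hρ, e⟩ := h4
    rw [charInner_one_ne_zero_iff, finsum_eq_sum_of_fintype] at h2
    have h5 : ∑ g, ρ.character g ≠ 0 := by rw [e]; exact h2
    exact e.symm.trans (character_eq_one_of_sum_ne_zero ρ hρ h5)
  exact hf (Units.ext (congrFun h3 ⟨x, hx⟩))

end Representations

/-! ### Central characters and extension of linear characters -/

theorem exists_centralCharacter {G V : Type*} [Group G] [AddCommGroup V] [Module ℂ V]
    [FiniteDimensional ℂ V] (ρ : Representation ℂ G V) (hρ : ρ.IsIrreducible) :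
    ∃ μ : Subgroup.center G →* ℂˣ, ∀ z : Subgroup.center G, ρ (z : G) = (μ z : ℂ) • 1 := by
  have := ((isIrreducible_iff ρ).1 hρ).1
  have key : ∀ z : Subgroup.center G, ∃ c : ℂ, ρ (z : G) = c • 1 := by
    intro z
    -- Schur's lemma: a central element acts by an intertwiner, hence by a scalar.
    let f : IntertwiningMap ρ ρ := ⟨ρ (z : G), fun g => by
      change ρ z * ρ g = ρ g * ρ z
      rw [← map_mul, ← map_mul, Subgroup.mem_center_iff.1 z.2 g]⟩
    obtain ⟨c, hc⟩ :=
      (IsIrreducible.algebraMap_intertwiningMap_bijective_of_isAlgClosed (ρ := ρ)).2 f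
    refine ⟨c, ?_⟩
    have : f.toLinearMap = (algebraMap ℂ (IntertwiningMap ρ ρ) c).toLinearMap := by rw [hc]
    ext v
    exact LinearMap.congr_fun this v
  choose c hc using key
  have inj : ∀ a b : ℂ, a • (1 : Module.End ℂ V) = b • 1 → a = b := fun a b h =>
    smul_left_injective ℂ (one_ne_zero (α := Module.End ℂ V)) h
  let m : Subgroup.center G →* ℂ :=
    { toFun := c
      map_one' := inj _ _ (by rw [← hc]; simp)
      map_mul' := fun x y => inj _ _ (by
        rw [← hc, Subgroup.coe_mul, map_mul, hc, hc, smul_mul_smul_comm, mul_one]) }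
  exact ⟨m.toHomUnits, hc⟩

/-- A linear character of a subgroup meeting the commutator subgroup trivially extends to the
whole group. -/
theorem exists_extension_of_disjoint_commutator {P : Type*} [Group P] [Finite P]
    (K : Subgroup P) (hK : Disjoint K (commutator P)) (μ : K →* ℂˣ) :
    ∃ f : P →* ℂˣ, (∀ k : K, f k = μ k) ∧ ∀ x ∈ commutator P, f x = 1 := by
  let j : K →* Abelianization P := Abelianization.of.comp K.subtype
  have hj : Function.Injective j := by
    rw [injective_iff_map_eq_one]
    intro k hk
    have : (k : P) ∈ commutator P := (QuotientGroup.eq_one_iff (k : P)).1 hk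
    exact Subtype.ext (Subgroup.disjoint_def.1 hK k.2 this)
  -- `K` embeds in the finite abelian group `Abelianization P`, where characters extend from
  -- subgroups.
  obtain ⟨F, hF⟩ := MonoidHom.domRestrict_surjective ℂ j.range
    (μ.comp (MonoidHom.ofInjective hj).symm.toMonoidHom)
  refine ⟨F.comp Abelianization.of, fun k => ?_, fun x hx => ?_⟩
  · have := DFunLike.congr_fun hF (MonoidHom.ofInjective hj k)
    rw [MonoidHom.domRestrictHom_apply, MonoidHom.domRestrict_apply] at this
    exact this.trans (congrArg μ ((MonoidHom.ofInjective hj).symm_apply_apply k))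
  · have : Abelianization.of x = 1 := (QuotientGroup.eq_one_iff x).2 hx
    simp [this]

/-! ### The fibre product and its commutator subgroup -/

section Pullback

variable {G₁ G₂ : Type*} [Group G₁] [Group G₂]

/-- The fibre product of two groups over a common central quotient. -/
def centralPullback (θ : (G₁ ⧸ Subgroup.center G₁) ≃* (G₂ ⧸ Subgroup.center G₂)) :
    Subgroup (G₁ × G₂) :=
  MonoidHom.eqLocus
    ((θ.toMonoidHom.comp (QuotientGroup.mk' _)).comp (MonoidHom.fst G₁ G₂))
    ((QuotientGroup.mk' _).comp (MonoidHom.snd G₁ G₂))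

variable {θ : (G₁ ⧸ Subgroup.center G₁) ≃* (G₂ ⧸ Subgroup.center G₂)}

theorem mem_centralPullback {p : G₁ × G₂} :
    p ∈ centralPullback θ ↔
      θ (p.1 : G₁ ⧸ Subgroup.center G₁) = (p.2 : G₂ ⧸ Subgroup.center G₂) := Iff.rfl

theorem exists_mem_centralPullback_fst (θ : (G₁ ⧸ Subgroup.center G₁) ≃* (G₂ ⧸ Subgroup.center G₂))
    (a : G₁) : ∃ b, (a, b) ∈ centralPullback θ := by
  obtain ⟨b, hb⟩ := QuotientGroup.mk_surjective (θ (a : G₁ ⧸ Subgroup.center G₁))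
  exact ⟨b, hb.symm⟩

theorem exists_mem_centralPullback_snd (θ : (G₁ ⧸ Subgroup.center G₁) ≃* (G₂ ⧸ Subgroup.center G₂))
    (b : G₂) : ∃ a, (a, b) ∈ centralPullback θ := by
  obtain ⟨a, ha⟩ := QuotientGroup.mk_surjective (θ.symm (b : G₂ ⧸ Subgroup.center G₂))
  exact ⟨a, by rw [mem_centralPullback]; simp [ha]⟩

variable {ψ : commutator G₁ ≃* commutator G₂}

theorem map_commutator_centralPullback
    (h : ∀ (a b : G₁) (c d : G₂), θ (a : G₁ ⧸ Subgroup.center G₁) = (c : G₂ ⧸ Subgroup.center G₂) →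
      θ (b : G₁ ⧸ Subgroup.center G₁) = (d : G₂ ⧸ Subgroup.center G₂) →
      ((ψ ⟨⁅a, b⁆, Subgroup.commutator_mem_commutator (Subgroup.mem_top a)
        (Subgroup.mem_top b)⟩ : commutator G₂) : G₂) = ⁅c, d⁆) :
    (commutator (centralPullback θ)).map (centralPullback θ).subtype =
      ((commutator G₁).subtype.prod ((commutator G₂).subtype.comp ψ.toMonoidHom)).range := by
  set f := (commutator G₁).subtype.prod ((commutator G₂).subtype.comp ψ.toMonoidHom) with hf
  apply le_antisymm
  · rw [Subgroup.map_le_iff_le_comap, commutator_def, Subgroup.commutator_le]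
    rintro ⟨⟨a, c⟩, hp⟩ - ⟨⟨b, d⟩, hq⟩ -
    exact ⟨⟨⁅a, b⁆, Subgroup.commutator_mem_commutator (Subgroup.mem_top a) (Subgroup.mem_top b)⟩,
      Prod.ext rfl (h a b c d hp hq)⟩
  -- The part of the graph lying in `P'` projects to a subgroup of `G₁`; it suffices that this
  -- contains every `⁅a, b⁆`, seen by lifting `a` and `b` to `P`.
  · set S := ((commutator (centralPullback θ)).map (centralPullback θ).subtype).comap f with hS
    have hle : commutator G₁ ≤ S.map (commutator G₁).subtype := by
      conv_lhs => rw [commutator_def]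
      rw [Subgroup.commutator_le]
      intro a _ b _
      obtain ⟨c, hc⟩ := exists_mem_centralPullback_fst θ a
      obtain ⟨d, hd⟩ := exists_mem_centralPullback_fst θ b
      refine ⟨⟨⁅a, b⁆, Subgroup.commutator_mem_commutator (Subgroup.mem_top a)
        (Subgroup.mem_top b)⟩, ?_, rfl⟩
      refine ⟨⁅⟨(a, c), hc⟩, ⟨(b, d), hd⟩⁆,
        Subgroup.commutator_mem_commutator (Subgroup.mem_top _) (Subgroup.mem_top _), ?_⟩
      exact Prod.ext rfl (h a b c d hc hd).symm
    rintro _ ⟨x, rfl⟩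
    obtain ⟨y, hy, e⟩ := hle x.2
    rwa [← Subtype.ext e]

end Pullback

/-! ### Transfer of irreducible characters along an isoclinism -/

theorem exists_lift_of_surjective {P G M : Type*} [Group P] [Group G] [Monoid M] (p : P →* G)
    (hp : Function.Surjective p) (τ : P →* M) (h : p.ker ≤ τ.ker) :
    ∃ ρ : G →* M, ∀ x, ρ (p x) = τ x := by
  refine ⟨(QuotientGroup.lift p.ker τ h).comp
    (QuotientGroup.quotientKerEquivOfSurjective p hp).symm.toMonoidHom, fun x => ?_⟩
  have : (QuotientGroup.quotientKerEquivOfSurjective p hp).symm (p x) = (x : P ⧸ p.ker) := by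
    rw [MulEquiv.symm_apply_eq]; rfl
  exact (congrArg (QuotientGroup.lift p.ker τ h) this).trans rfl

/-- Let `G₁`, `G₂` be quotients of `P` such that the kernel of `P → G₁` meets the commutator
subgroup trivially and is central in `G₂`. Then every irreducible character of `G₂` agrees on the
commutator subgroup of `P` with an irreducible character of `G₁`. -/
theorem exists_mem_Irr_eq_on_commutator_of_surjective {P G₁ G₂ : Type*} [Group P] [Finite P]
    [Group G₁] [Group G₂] (p₁ : P →* G₁) (p₂ : P →* G₂) (hp₁ : Function.Surjective p₁)
    (hp₂ : Function.Surjective p₂) (hker : ∀ k : p₁.ker, p₂.comp p₁.ker.subtype k ∈ Subgroup.center G₂)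
    (hdisj : Disjoint p₁.ker (commutator P)) {χ : G₂ → ℂ} (hχ : χ ∈ Irr G₂) :
    ∃ χ' ∈ Irr G₁, ∀ p ∈ commutator P, χ' (p₁ p) = χ (p₂ p) := by
  obtain ⟨n, ρ, hρ, rfl⟩ := hχ
  obtain ⟨μ, hμ⟩ := exists_centralCharacter ρ hρ
  obtain ⟨f, hf, hf'⟩ := exists_extension_of_disjoint_commutator p₁.ker hdisj
    (μ.comp ((p₂.comp p₁.ker.subtype).codRestrict _ hker))
  let τ : P →* Module.End ℂ (Fin n → ℂ) :=
    { toFun := fun p => ((f p)⁻¹ : ℂˣ) • ρ (p₂ p)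
      map_one' := by simp
      map_mul' := fun p q => by
        rw [map_mul, map_mul, map_mul, mul_inv, smul_mul_smul_comm] }
  have hτ : ∀ p, τ p = ((f p)⁻¹ : ℂˣ) • ρ (p₂ p) := fun p => rfl
  have hτker : p₁.ker ≤ τ.ker := by
    intro k hk
    have h1 : ρ (p₂ k) = f k • 1 := by
      rw [hf ⟨k, hk⟩]
      exact hμ ⟨p₂ k, hker ⟨k, hk⟩⟩
    rw [MonoidHom.mem_ker, hτ, h1, smul_smul, inv_mul_cancel, one_smul]
  obtain ⟨ρ₁, hρ₁⟩ : ∃ ρ₁ : Representation ℂ G₁ (Fin n → ℂ), ∀ p, ρ₁ (p₁ p) = τ p :=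
    exists_lift_of_surjective p₁ hp₁ τ hτker
  simp only [hτ] at hρ₁
  refine ⟨ρ₁.character, character_mem_Irr ρ₁ ?_, fun p hp => ?_⟩
  -- Twisting by the scalars `f p` does not change the invariant subspaces.
  · rw [isIrreducible_iff] at hρ ⊢
    refine ⟨hρ.1, fun U hU => hρ.2 U fun g v hv => ?_⟩
    obtain ⟨p, rfl⟩ := hp₂ g
    have h1 := hU (p₁ p) v hv
    rw [hρ₁] at h1
    have h3 := U.smul_mem ((f p : ℂˣ) : ℂ) h1
    rwa [LinearMap.smul_apply, Units.smul_def, smul_smul, Units.mul_inv, one_smul] at h3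
  · rw [character, character, hρ₁, hf' p hp, inv_one, one_smul]

theorem exists_mem_Irr_eq_on_commutator {G₁ G₂ : Type*} [Group G₁] [Group G₂] [Finite G₁]
    [Finite G₂] {θ : (G₁ ⧸ Subgroup.center G₁) ≃* (G₂ ⧸ Subgroup.center G₂)}
    {ψ : commutator G₁ ≃* commutator G₂}
    (h : ∀ (a b : G₁) (c d : G₂), θ (a : G₁ ⧸ Subgroup.center G₁) = (c : G₂ ⧸ Subgroup.center G₂) →
      θ (b : G₁ ⧸ Subgroup.center G₁) = (d : G₂ ⧸ Subgroup.center G₂) →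
      ((ψ ⟨⁅a, b⁆, Subgroup.commutator_mem_commutator (Subgroup.mem_top a)
        (Subgroup.mem_top b)⟩ : commutator G₂) : G₂) = ⁅c, d⁆)
    {χ : G₂ → ℂ} (hχ : χ ∈ Irr G₂) :
    ∃ χ' ∈ Irr G₁, ∀ x : commutator G₁, χ' x = χ (ψ x) := by
  have hmap := map_commutator_centralPullback h
  let p₁ : centralPullback θ →* G₁ := (MonoidHom.fst G₁ G₂).comp (centralPullback θ).subtype
  let p₂ : centralPullback θ →* G₂ := (MonoidHom.snd G₁ G₂).comp (centralPullback θ).subtype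
  have hp₁ : Function.Surjective p₁ := fun a => by
    obtain ⟨b, hb⟩ := exists_mem_centralPullback_fst θ a
    exact ⟨⟨_, hb⟩, rfl⟩
  have hp₂ : Function.Surjective p₂ := fun b => by
    obtain ⟨a, ha⟩ := exists_mem_centralPullback_snd θ b
    exact ⟨⟨_, ha⟩, rfl⟩
  have hker : ∀ k : p₁.ker, p₂.comp p₁.ker.subtype k ∈ Subgroup.center G₂ := by
    rintro ⟨⟨⟨a, b⟩, hab⟩, hk⟩
    obtain rfl : a = 1 := hk
    change b ∈ Subgroup.center G₂
    rw [mem_centralPullback] at hab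
    rw [← QuotientGroup.eq_one_iff, ← hab]
    exact map_one θ
  have hdisj : Disjoint p₁.ker (commutator (centralPullback θ)) := by
    rw [Subgroup.disjoint_def]
    intro p hp hp'
    -- A point of the graph of `ψ` with trivial first coordinate is trivial.
    obtain ⟨x, hx⟩ := hmap.le ⟨p, hp', rfl⟩
    have h1 : (x : G₁) = 1 := (congrArg Prod.fst hx).trans hp
    obtain rfl : x = 1 := Subtype.ext h1
    exact Subtype.ext (hx.symm.trans (map_one _))
  obtain ⟨χ', hχ', e⟩ := exists_mem_Irr_eq_on_commutator_of_surjective p₁ p₂ hp₁ hp₂ hker hdisj hχ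
  refine ⟨χ', hχ', fun x => ?_⟩
  obtain ⟨p, hp, hpx⟩ := hmap.ge ⟨x, rfl⟩
  have e1 : p₁ p = x := congrArg Prod.fst hpx
  have e2 : p₂ p = ψ x := congrArg Prod.snd hpx
  rw [← e1, ← e2]
  exact e p hp

theorem Isoclinic.exists_commutator_equiv {G₁ G₂ : Type*} [Group G₁] [Group G₂] [Finite G₁]
    [Finite G₂] (h : Isoclinic G₁ G₂) :
    ∃ ψ : commutator G₁ ≃* commutator G₂,
      (∀ χ ∈ Irr G₂, ∃ χ' ∈ Irr G₁, ∀ x : commutator G₁, χ' x = χ (ψ x)) ∧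
      ∀ χ ∈ Irr G₁, ∃ χ' ∈ Irr G₂, ∀ x : commutator G₁, χ x = χ' (ψ x) := by
  obtain ⟨θ, ψ, h⟩ := h
  refine ⟨ψ, fun χ hχ => exists_mem_Irr_eq_on_commutator h hχ, fun χ hχ => ?_⟩
  have hsymm := exists_mem_Irr_eq_on_commutator (θ := θ.symm) (ψ := ψ.symm)
    (fun a b c d hac hbd => by
      have := h c d a b (by rw [← hac, θ.apply_symm_apply]) (by rw [← hbd, θ.apply_symm_apply])
      have h2 := congrArg ψ.symm (Subtype.ext this : _ = (⟨⁅a, b⁆,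
        Subgroup.commutator_mem_commutator (Subgroup.mem_top a) (Subgroup.mem_top b)⟩ :
          commutator G₂))
      rw [ψ.symm_apply_apply] at h2
      rw [← h2]) hχ
  obtain ⟨χ', hχ', e⟩ := hsymm
  exact ⟨χ', hχ', fun x => by rw [e, ψ.symm_apply_apply]⟩

/-! ### Diameter 3 in bipartite graphs -/

theorem ediam_eq_three_iff {α β : Type*} [Nonempty α] [Nonempty β] (Γ : SimpleGraph (α ⊕ β))
    (hα : ∀ a a', ¬ Γ.Adj (.inl a) (.inl a')) (hβ : ∀ b b', ¬ Γ.Adj (.inr b) (.inr b')) :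
    Γ.ediam = 3 ↔
      (∀ a a', ∃ b, Γ.Adj (.inl a) (.inr b) ∧ Γ.Adj (.inl a') (.inr b)) ∧
      (∀ b b', ∃ a, Γ.Adj (.inl a) (.inr b) ∧ Γ.Adj (.inl a) (.inr b')) ∧
      ∃ a b, ¬ Γ.Adj (.inl a) (.inr b) := by
  constructor
  · intro h
    have hw : ∀ u v, ∃ w : Γ.Walk u v, w.length ≤ 3 := by
      intro u v
      have h1 : Γ.edist u v ≤ 3 := h ▸ SimpleGraph.edist_le_ediam
      obtain ⟨w, hw⟩ := SimpleGraph.exists_walk_of_edist_ne_top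
        (ne_top_of_le_ne_top (by decide) h1)
      exact ⟨w, by rw [← hw] at h1; exact_mod_cast h1⟩
    -- By parity, a walk of length at most 3 between vertices on one side has length 0 or 2. In
    -- length 0, any walk to the other side supplies a neighbour.
    refine ⟨fun a a' => ?_, fun b b' => ?_, ?_⟩
    · obtain ⟨w, hw'⟩ := hw (.inl a) (.inl a')
      match w, hw' with
      | .nil, _ =>
        obtain ⟨b⟩ := ‹Nonempty β›
        obtain ⟨w, -⟩ := hw (.inl a) (.inr b)
        match w with
        | .cons (v := .inl _) h1 _ => exact absurd h1 (hα _ _)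
        | .cons (v := .inr b') h1 _ => exact ⟨b', h1, h1⟩
      | .cons (v := .inl _) h1 _, _ => exact absurd h1 (hα _ _)
      | .cons (v := .inr b) h1 (.cons h2 .nil), _ => exact ⟨b, h1, h2.symm⟩
      | .cons (v := .inr b) h1 (.cons (v := .inr _) h2 _), _ => exact absurd h2 (hβ _ _)
      | .cons (v := .inr b) h1 (.cons (v := .inl _) h2 (.cons h3 .nil)), _ =>
        exact absurd h3 (hα _ _)
      | .cons _ (.cons _ (.cons _ (.cons _ _))), hl =>
        simp only [SimpleGraph.Walk.length_cons] at hl; omega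
    · obtain ⟨w, hw'⟩ := hw (.inr b) (.inr b')
      match w, hw' with
      | .nil, _ =>
        obtain ⟨a⟩ := ‹Nonempty α›
        obtain ⟨w, -⟩ := hw (.inr b) (.inl a)
        match w with
        | .cons (v := .inr _) h1 _ => exact absurd h1 (hβ _ _)
        | .cons (v := .inl a') h1 _ => exact ⟨a', h1.symm, h1.symm⟩
      | .cons (v := .inr _) h1 _, _ => exact absurd h1 (hβ _ _)
      | .cons (v := .inl a) h1 (.cons h2 .nil), _ => exact ⟨a, h1.symm, h2⟩
      | .cons (v := .inl a) h1 (.cons (v := .inl _) h2 _), _ => exact absurd h2 (hα _ _)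
      | .cons (v := .inl a) h1 (.cons (v := .inr _) h2 (.cons h3 .nil)), _ =>
        exact absurd h3 (hβ _ _)
      | .cons _ (.cons _ (.cons _ (.cons _ _))), hl =>
        simp only [SimpleGraph.Walk.length_cons] at hl; omega
    -- A complete bipartite graph has diameter at most 2.
    · by_contra! hadj
      have h2 : Γ.ediam ≤ 2 := by
        obtain ⟨a⟩ := ‹Nonempty α›
        obtain ⟨b⟩ := ‹Nonempty β›
        refine SimpleGraph.ediam_le_of_edist_le fun u v => ?_
        rcases u with a₁ | b₁ <;> rcases v with a₂ | b₂
        · exact SimpleGraph.edist_le (.cons (hadj a₁ b) (.cons (hadj a₂ b).symm .nil))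
        · exact (SimpleGraph.edist_le (.cons (hadj a₁ b₂) .nil)).trans (by norm_num)
        · exact (SimpleGraph.edist_le (.cons (hadj a₂ b₁).symm .nil)).trans (by norm_num)
        · exact SimpleGraph.edist_le (.cons (hadj a b₁).symm (.cons (hadj a b₂) .nil))
      rw [h] at h2
      exact absurd h2 (by decide)
  · rintro ⟨hA, hB, a, b, hab⟩
    have mixed : ∀ a b, Γ.edist (.inl a) (.inr b) ≤ 3 := by
      intro a b
      obtain ⟨a', h1, -⟩ := hB b b
      obtain ⟨b', h2, h3⟩ := hA a a'
      exact SimpleGraph.edist_le (.cons h2 (.cons h3.symm (.cons h1 .nil)))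
    apply le_antisymm
    · refine SimpleGraph.ediam_le_of_edist_le fun u v => ?_
      rcases u with a₁ | b₁ <;> rcases v with a₂ | b₂
      · obtain ⟨b, h1, h2⟩ := hA a₁ a₂
        exact (SimpleGraph.edist_le (.cons h1 (.cons h2.symm .nil))).trans (by norm_num)
      · exact mixed _ _
      · rw [SimpleGraph.edist_comm]; exact mixed _ _
      · obtain ⟨a, h1, h2⟩ := hB b₁ b₂
        exact (SimpleGraph.edist_le (.cons h1.symm (.cons h2 .nil))).trans (by norm_num)
    · refine le_trans ?_ (SimpleGraph.edist_le_ediam (u := .inl a) (v := .inr b))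
      have h2 : 2 < Γ.edist (.inl a) (.inr b) := by
        rw [SimpleGraph.two_lt_edist_iff]
        refine ⟨by simp, hab, ?_⟩
        rw [Set.eq_empty_iff_forall_notMem]
        rintro (c | c) ⟨h1, h2⟩
        · exact hα _ _ h1
        · exact hβ _ _ h2
      exact Order.add_one_le_of_lt h2

/-! ### Diameter 3 and richness for Frobenius graphs -/

section

variable {G G' : Type*} [Group G] [Group G']

theorem comp_mulEquiv_mem_Irr (e : G ≃* G') {φ : G' → ℂ} (hφ : φ ∈ Irr G') : φ ∘ e ∈ Irr G := by
  obtain ⟨n, ρ, hρ, rfl⟩ := hφ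
  refine ⟨n, ρ.comp e.toMonoidHom, ?_, rfl⟩
  rw [isIrreducible_iff] at hρ ⊢
  refine ⟨hρ.1, fun U hU => hρ.2 U fun g v hv => ?_⟩
  simpa using hU (e.symm g) v hv

theorem charInner_comp_mulEquiv [Finite G] [Finite G'] (e : G ≃* G') (α β : G' → ℂ) :
    charInner (α ∘ e) (β ∘ e) = charInner α β := by
  rw [charInner, charInner, Nat.card_congr e.toEquiv]
  congr 1
  exact finsum_eq_of_bijective e e.bijective fun _ => rfl

theorem frobeniusGraph_ediam_eq_three_iff [Finite G] (H : Subgroup G) :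
    (frobeniusGraph H).ediam = 3 ↔
      (∀ χ ∈ Irr G, ∀ χ' ∈ Irr G, ∃ φ ∈ Irr H,
        charInner (res H χ) φ ≠ 0 ∧ charInner (res H χ') φ ≠ 0) ∧
      (∀ φ ∈ Irr H, ∀ φ' ∈ Irr H, ∃ χ ∈ Irr G,
        charInner (res H χ) φ ≠ 0 ∧ charInner (res H χ) φ' ≠ 0) ∧
      ∃ χ ∈ Irr G, ∃ φ ∈ Irr H, charInner (res H χ) φ = 0 := by
  have : Nonempty (Irr G) := ⟨⟨_, one_mem_Irr⟩⟩
  have : Nonempty (Irr H) := ⟨⟨_, one_mem_Irr⟩⟩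
  rw [ediam_eq_three_iff _ (fun _ _ h => h) (fun _ _ h => h)]
  simp [frobeniusGraph, and_left_comm]

/-- `χ` and `1_G` have a common neighbour, and the only neighbour of `1_G` is `1_H`. -/
theorem charInner_one_ne_zero_of_ediam_eq_three [Finite G] {H : Subgroup G}
    (h : (frobeniusGraph H).ediam = 3) :
    ∀ χ ∈ Irr G, charInner (res H χ) (fun _ => 1) ≠ 0 := by
  intro χ hχ
  obtain ⟨φ, hφ, h1, h2⟩ := ((frobeniusGraph_ediam_eq_three_iff H).1 h).1 χ hχ _ one_mem_Irr
  rwa [eq_one_of_charInner_one_ne_zero hφ h2] at h1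

theorem subsingleton_of_top_rich [Finite G]
    (h : ∀ χ ∈ Irr G, charInner (res (⊤ : Subgroup G) χ) (fun _ => 1) ≠ 0) : Subsingleton G := by
  refine subsingleton_of_forall_irreducible fun χ hχ => ?_
  rw [← charInner_one_ne_zero_iff]
  have := h χ hχ
  rwa [← charInner_comp_mulEquiv Subgroup.topEquiv.symm] at this

end

/-! ### Transport from `H₁` to `H₂` -/

section Transport

variable {G₁ G₂ : Type*} [Group G₁] [Group G₂]

/-- An isomorphism of subgroups which matches the restrictions of irreducible characters. -/
structure RestrictionEquiv (H₁ : Subgroup G₁) (H₂ : Subgroup G₂) where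
  toMulEquiv : H₁ ≃* H₂
  exists_left : ∀ χ ∈ Irr G₂, ∃ χ' ∈ Irr G₁, res H₁ χ' = res H₂ χ ∘ toMulEquiv
  exists_right : ∀ χ ∈ Irr G₁, ∃ χ' ∈ Irr G₂, res H₁ χ = res H₂ χ' ∘ toMulEquiv

theorem Isoclinic.exists_restrictionEquiv [Finite G₁] [Finite G₂] (h : Isoclinic G₁ G₂)
    {H₁ : Subgroup G₁} (hH : H₁ ≤ commutator G₁) :
    ∃ H₂ : Subgroup G₂, Nonempty (RestrictionEquiv H₁ H₂) := by
  obtain ⟨ψ, hl, hr⟩ := h.exists_commutator_equiv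
  let j : H₁ →* G₂ := (commutator G₂).subtype.comp (ψ.toMonoidHom.comp (Subgroup.inclusion hH))
  have hj : Function.Injective j :=
    Subtype.val_injective.comp (ψ.injective.comp (Subgroup.inclusion_injective hH))
  refine ⟨j.range, ⟨MonoidHom.ofInjective hj, fun χ hχ => ?_, fun χ hχ => ?_⟩⟩
  · obtain ⟨χ', hχ', e⟩ := hl χ hχ
    exact ⟨χ', hχ', funext fun x => e (Subgroup.inclusion hH x)⟩
  · obtain ⟨χ', hχ', e⟩ := hr χ hχ
    exact ⟨χ', hχ', funext fun x => e (Subgroup.inclusion hH x)⟩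

namespace RestrictionEquiv

variable [Finite G₁] [Finite G₂] {H₁ : Subgroup G₁} {H₂ : Subgroup G₂}

theorem charInner_one_ne_zero (e : RestrictionEquiv H₁ H₂)
    (h : ∀ χ ∈ Irr G₁, charInner (res H₁ χ) (fun _ => 1) ≠ 0) :
    ∀ χ ∈ Irr G₂, charInner (res H₂ χ) (fun _ => 1) ≠ 0 := by
  intro χ hχ
  obtain ⟨χ', hχ', he⟩ := e.exists_left χ hχ
  rw [← charInner_comp_mulEquiv e.toMulEquiv, ← he]
  exact h χ' hχ'

theorem ediam_eq_three (e : RestrictionEquiv H₁ H₂) (h : (frobeniusGraph H₁).ediam = 3) :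
    (frobeniusGraph H₂).ediam = 3 := by
  rw [frobeniusGraph_ediam_eq_three_iff] at h ⊢
  obtain ⟨hA, hB, χ, hχ, φ, hφ, h0⟩ := h
  have hinv : ∀ φ : H₁ → ℂ, (φ ∘ e.toMulEquiv.symm) ∘ e.toMulEquiv = φ := fun φ => by
    ext x; simp
  refine ⟨fun χ hχ χ' hχ' => ?_, fun φ hφ φ' hφ' => ?_, ?_⟩
  · obtain ⟨η, hη, he⟩ := e.exists_left χ hχ
    obtain ⟨η', hη', he'⟩ := e.exists_left χ' hχ'
    obtain ⟨φ, hφ, h1, h2⟩ := hA η hη η' hη'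
    refine ⟨φ ∘ e.toMulEquiv.symm, comp_mulEquiv_mem_Irr _ hφ, ?_, ?_⟩
    · rwa [← charInner_comp_mulEquiv e.toMulEquiv, ← he, hinv]
    · rwa [← charInner_comp_mulEquiv e.toMulEquiv, ← he', hinv]
  · obtain ⟨η, hη, h1, h2⟩ := hB _ (comp_mulEquiv_mem_Irr e.toMulEquiv hφ) _
      (comp_mulEquiv_mem_Irr e.toMulEquiv hφ')
    obtain ⟨χ, hχ, he⟩ := e.exists_right η hη
    rw [he, charInner_comp_mulEquiv] at h1 h2
    exact ⟨χ, hχ, h1, h2⟩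
  · obtain ⟨χ', hχ', he⟩ := e.exists_right χ hχ
    refine ⟨χ', hχ', φ ∘ e.toMulEquiv.symm, comp_mulEquiv_mem_Irr _ hφ, ?_⟩
    rwa [← charInner_comp_mulEquiv e.toMulEquiv, ← he, hinv]

end RestrictionEquiv

/-- Over `H = 1` every inner product is a product of nonzero degrees, so the graph would be complete
bipartite. -/
theorem nontrivial_of_ediam_eq_three [Finite G₁] {H : Subgroup G₁}
    (h : (frobeniusGraph H).ediam = 3) : Nontrivial H := by
  obtain ⟨-, -, χ, hχ, φ, hφ, h0⟩ := (frobeniusGraph_ediam_eq_three_iff H).1 h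
  by_contra hH
  rw [not_nontrivial_iff_subsingleton] at hH
  have : Fintype H := Fintype.ofFinite H
  have h1 : χ 1 ≠ 0 := apply_one_ne_zero hχ
  have h2 : φ 1 ≠ 0 := apply_one_ne_zero hφ
  simp [charInner, finsum_eq_sum_of_fintype, Fintype.sum_subsingleton _ (1 : H), res, h1, h2] at h0

end Transport

end FrobeniusDiam

theorem mainTheorem6 {G₁ : Type*} {G₂ : Type*} [Group G₁] [Group G₂] [Finite G₁] [Finite G₂]
    (hiso : FrobeniusDiam.Isoclinic G₁ G₂) (H₁ : Subgroup G₁) (hH₁ : H₁ ≠ ⊤) :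
    (FrobeniusDiam.IsRich H₁ →
      (H₁ ≠ ⊥ → ∃ H₂ : Subgroup G₂, H₂ ≠ ⊤ ∧ H₂ ≠ ⊥ ∧ FrobeniusDiam.IsRich H₂) ∧
      (Nontrivial G₂ → ∃ H₂ : Subgroup G₂, H₂ ≠ ⊤ ∧ FrobeniusDiam.IsRich H₂)) ∧
    ((FrobeniusDiam.frobeniusGraph H₁).ediam = 3 →
      ∃ H₂ : Subgroup G₂, H₂ ≠ ⊤ ∧ (FrobeniusDiam.frobeniusGraph H₂).ediam = 3) := by
  open FrobeniusDiam in
  have ne_top : ∀ {H₂ : Subgroup G₂}, Nontrivial G₂ →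
      (∀ χ ∈ Irr G₂, charInner (res H₂ χ) (fun _ => 1) ≠ 0) → H₂ ≠ ⊤ := by
    rintro _ hG h rfl
    exact not_subsingleton G₂ (subsingleton_of_top_rich h)
  refine ⟨fun hr => ?_, fun hd => ?_⟩
  · obtain ⟨H₂, ⟨e⟩⟩ :=
      hiso.exists_restrictionEquiv (FrobeniusDiam.le_commutator_of_forall H₁ hr.2)
    have h2 := e.charInner_one_ne_zero hr.2
    refine ⟨fun hb => ?_, fun hG => ⟨H₂, ne_top hG h2, ne_top hG h2, h2⟩⟩
    have : Nontrivial H₁ := (Subgroup.nontrivial_iff_ne_bot H₁).2 hb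
    have hn : Nontrivial H₂ := e.toMulEquiv.symm.toEquiv.nontrivial
    have hG : Nontrivial G₂ := Subtype.val_injective.nontrivial (α := H₂)
    exact ⟨H₂, ne_top hG h2, (Subgroup.nontrivial_iff_ne_bot H₂).1 hn, ne_top hG h2, h2⟩
  · have h1 := FrobeniusDiam.charInner_one_ne_zero_of_ediam_eq_three hd
    obtain ⟨H₂, ⟨e⟩⟩ :=
      hiso.exists_restrictionEquiv (FrobeniusDiam.le_commutator_of_forall H₁ h1)
    -- Nontriviality of `G₂` is not assumed here; it comes from `H₁ ≠ 1` through `H₁ ≃* H₂`.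
    have : Nontrivial H₁ := FrobeniusDiam.nontrivial_of_ediam_eq_three hd
    have hn : Nontrivial H₂ := e.toMulEquiv.symm.toEquiv.nontrivial
    have hG : Nontrivial G₂ := Subtype.val_injective.nontrivial (α := H₂)
    exact ⟨H₂, ne_top hG (e.charInner_one_ne_zero h1), e.ediam_eq_three hd⟩
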